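/- **Proposition 3.2.** Let $\mathcal H$ be a real Hilbert space and let $A,B:\mathcal H\rightrightarrows\mathcal H$ be set-valued maximal monotone operators such that $\operatorname{zer}(A+B):=\{x\in\mathcal H : 0\in Ax+Bx\}\neq\emptyset$. Let $\Delta_k$ $(k\in\mathbb N)$ and $\Delta$ be bounded linear operators on $\mathcal H$ that are boundedly invertible, self-adjoint and positive definite ($\langle \Delta_k x,x\rangle>0$ and $\langle\Delta x,x\rangle>0$ for all $x\ne 0$). Suppose that there are constants $\overline C,\underline C$ with $\|\Delta_k\|\le\overline C$ and $\|\Delta_k^{-1}\|\le\underline C$ for all $k$, and that $$\Delta_k\to\Delta\ \text{ in operator norm},\qquad \sum_{k\in\mathbb N}\|\Delta_{k+1}-\Delta_k\|<\infty .$$ For a set-valued operator $T:\mathcal H\rightrightarrows\mathcal H$ let $J_T:=(\mathbb I+T)^{-1}$ be its resolvent, i.e. $p\in J_T v$ if and only if $v\in p+Tp$, and let $\Delta_kA$ denote the operator $x\mapsto\{\Delta_k u : u\in Ax\}$ (likewise $\Delta_kB$). Then all resolvents $J_{\Delta_kA}$ and $J_{\Delta_kB}$ are single-valued and defined on all of $\mathcal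 H$, and for every $w^0\in\mathcal H$ and the sequence $(w^k)_{k\in\mathbb N}$ generated by $$w^{k+1}=w^k+J_{\Delta_kB}\bigl(2J_{\Delta_kA}w^k-w^k\bigr)-J_{\Delta_kA}w^k ,$$ the sequence $(J_{\Delta_kA}w^k)_{k\in\mathbb N}$ converges weakly to some $x\in\operatorname{zer}(A+B)$. -/

import Mathlib

open Filter Topology
open scoped InnerProductSpace Pointwise

namespace SetValued

variable {H : Type*} [NormedAddCommGroup H] [InnerProductSpace ℝ H]

/-- A set-valued operator `T : H ⇉ H` (a map `H → Set H`) is monotone if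
`⟪x - y, u - v⟫ ≥ 0` for all `(x, u)`, `(y, v)` in its graph. -/
def IsMonotone (T : H → Set H) : Prop :=
  ∀ x y : H, ∀ u ∈ T x, ∀ v ∈ T y, 0 ≤ ⟪x - y, u - v⟫_ℝ

/-- A set-valued operator is maximal monotone if it is monotone and its graph is not properly
contained in the graph of another monotone operator. The order on `H → Set H` is pointwise
inclusion, which is inclusion of graphs. -/
def IsMaximalMonotone (T : H → Set H) : Prop :=
  Maximal IsMonotone T

/-- The set of zeros `zer T = {x | 0 ∈ T x}`. -/
def zer (T : H → Set H) : Set H := {x | (0 : H) ∈ T x}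

/-- The set-valued inverse: `x ∈ T⁻¹ y` if and only if `y ∈ T x`. -/
def inverse (T : H → Set H) : H → Set H := fun y => {x | y ∈ T x}

/-- The identity mapping, as a set-valued operator. -/
def ident : H → Set H := fun x => {x}

/-- The resolvent `J_T = (I + T)⁻¹`, as a set-valued operator. -/
def resolvent (T : H → Set H) : H → Set H := inverse (ident + T)

/-- The composition `D T : x ↦ {D u | u ∈ T x}` of a bounded linear operator `D` with a
set-valued operator `T`. -/
def precond (D : H →L[ℝ] H) (T : H → Set H) : H → Set H := fun x => D '' T x

/-- A bounded linear operator `D` is self-adjoint and positive definite: `D` is symmetric and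
`⟪D x, x⟫ > 0` for all `x ≠ 0`. -/
def IsSelfAdjointPosDef (D : H →L[ℝ] H) : Prop :=
  D.IsSymmetric ∧ ∀ x : H, x ≠ 0 → 0 < ⟪D x, x⟫_ℝ

end SetValued

/-! Write `p k`, `q k` for the two resolvent values, with `a k ∈ A (p k)`, `b k ∈ B (q k)`; then `w
k = p k + Δ k (a k)` and `p k - q k = Δ k (a k + b k)`. If `u ∈ A x` and `-u ∈ B x`, then `x + Δ k
u` is fixed by the `k`-th step, which is Fejér monotone in the metric of `(Δ k)⁻¹` with decrement
the squared length of `p k - q k`. Passing to the next metric and fixed point costs a summable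
relative error, so these distances converge and `p k - q k`, `a k + b k` tend to `0`
(`tendsto_douglasRachford_fejer`).

Weak limits of `(p, a)` along ultrafilters are again pairs `(x, u)` of this kind
(`mem_and_neg_mem_of_weaklyTendsto`), and an Opial argument shows that all of them share the same
`x`. Resolvents are total by Minty's theorem, proved through the Fitzpatrick function. -/

namespace SetValued

/-! ### Minimization of strongly convex functions -/

/-- A lower-bounded supremum of continuous affine functions `ℓ i` plus a coercive quadratic
function `Q`, described through its sublevel sets, grows quadratically around a minimizer. -/
theorem exists_quadratic_growth_point {E ι : Type*} [NormedAddCommGroup E] [NormedSpace ℝ E]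
    [CompleteSpace E] (ℓ : ι → E → ℝ) (Q : E → ℝ) (hℓc : ∀ i, Continuous (ℓ i))
    (hQc : Continuous Q)
    (hℓ : ∀ i a b (t : ℝ), ℓ i (a + t • (b - a)) = (1 - t) * ℓ i a + t * ℓ i b)
    (hQ : ∀ a b (t : ℝ), Q (a + t • (b - a)) = (1 - t) * Q a + t * Q b - t * (1 - t) * Q (b - a))
    {c : ℝ} (hc : 0 < c) (hQc' : ∀ z, c * ‖z‖ ^ 2 ≤ Q z)
    (hne : ∃ s z, ∀ i, ℓ i z + Q z ≤ s)
    (hnn : ∀ s z, (∀ i, ℓ i z + Q z ≤ s) → 0 ≤ s) :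
    ∃ z₀, ∀ s a, (∀ i, ℓ i a + Q a ≤ s) → Q (a - z₀) ≤ s := by
  set S : Set ℝ := {s | ∃ z, ∀ i, ℓ i z + Q z ≤ s} with hS
  have hbdd : BddBelow S := ⟨0, fun s ⟨z, hz⟩ => hnn s z hz⟩
  set m := sInf S with hm
  have hm0 : 0 ≤ m := le_csInf hne fun s ⟨z, hz⟩ => hnn s z hz
  have key : ∀ s s' z a (t : ℝ), (∀ i, ℓ i z + Q z ≤ s) → (∀ i, ℓ i a + Q a ≤ s') → 0 ≤ t → t ≤ 1 →
      m ≤ (1 - t) * s + t * s' - t * (1 - t) * Q (a - z) := by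
    intro s s' z a t hz ha ht0 ht1
    refine csInf_le hbdd ⟨z + t • (a - z), fun i => ?_⟩
    rw [hℓ, hQ]
    nlinarith [mul_le_mul_of_nonneg_left (hz i) (sub_nonneg.2 ht1),
      mul_le_mul_of_nonneg_left (ha i) ht0]
  have hex : ∀ n : ℕ, ∃ z, ∀ i, ℓ i z + Q z ≤ m + 1 / ((n : ℝ) + 1) := by
    intro n
    obtain ⟨s, ⟨z, hz⟩, hs⟩ := exists_lt_of_csInf_lt hne
      (lt_add_of_pos_right m (Nat.one_div_pos_of_nat (n := n) (α := ℝ)))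
    exact ⟨z, fun i => (hz i).trans hs.le⟩
  choose z hz using hex
  have hlim : Tendsto (fun n : ℕ => 1 / ((n : ℝ) + 1)) atTop (𝓝 0) :=
    tendsto_one_div_add_atTop_nhds_zero_nat
  have hcauchy : CauchySeq z := by
    refine cauchySeq_of_le_tendsto_0 (fun n : ℕ => 2 * √(4 / c * (1 / ((n : ℝ) + 1)))) ?_ ?_
    · intro n k N hn hk
      have aux : ∀ j, N ≤ j → ∀ i, ℓ i (z j) + Q (z j) ≤ m + 1 / ((N : ℝ) + 1) := fun j hj i =>
        (hz j i).trans (by gcongr)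
      -- The midpoint of two near-minimizers has value at least `m`, which forces `Q (z n - z k) ≤ 4
      -- / (N + 1)`.
      have h := key _ _ _ _ (1 / 2) (aux k hk) (aux n hn) (by norm_num) (by norm_num)
      have h2 := hQc' (z n - z k)
      rw [dist_eq_norm]
      have h3 : ‖z n - z k‖ ≤ √(4 / c * (1 / ((N : ℝ) + 1))) := by
        apply Real.le_sqrt_of_sq_le
        rw [div_mul_eq_mul_div, le_div_iff₀ hc]
        nlinarith
      linarith [norm_nonneg (z n - z k)]
    · have := (((hlim.const_mul (4 / c)).sqrt).const_mul 2)
      simpa using this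
  obtain ⟨z₀, hz₀⟩ := cauchySeq_tendsto_of_complete hcauchy
  have hmin : ∀ i, ℓ i z₀ + Q z₀ ≤ m := by
    intro i
    have h1 : Tendsto (fun n => ℓ i (z n) + Q (z n)) atTop (𝓝 (ℓ i z₀ + Q z₀)) :=
      (((hℓc i).tendsto _).comp hz₀).add ((hQc.tendsto _).comp hz₀)
    have h2 : Tendsto (fun n : ℕ => m + 1 / ((n : ℝ) + 1)) atTop (𝓝 m) := by
      simpa using hlim.const_add m
    exact le_of_tendsto_of_tendsto' h1 h2 fun n => hz n i
  refine ⟨z₀, fun s a ha => ?_⟩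
  have hs : m ≤ s := csInf_le hbdd ⟨a, ha⟩
  by_contra! hlt
  have hQpos : 0 < Q (a - z₀) := by linarith
  set q := Q (a - z₀)
  -- Convexity divided by `t` gives `m ≤ s - q + t * q`; this choice makes the right side `(s - q) /
  -- 2 < 0`, against `0 ≤ m`.
  set t := (q - s) / (2 * q) with ht
  have ht0 : 0 < t := by apply div_pos <;> linarith
  have ht1 : t ≤ 1 := by rw [ht, div_le_one (by linarith)]; linarith
  have htq : t * q = (q - s) / 2 := by rw [ht]; field_simp
  have h := key _ _ _ _ t hmin ha ht0.le ht1
  have h' : t * m ≤ t * (s - (1 - t) * q) := by linarith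
  have := le_of_mul_le_mul_left h' ht0
  linarith

/-! ### Maximal monotone operators and resolvents -/

variable {H : Type*} [NormedAddCommGroup H] [InnerProductSpace ℝ H]

/-- Adjoining `(x, u)` to the graph keeps it monotone, so by maximality the pair was already there.
-/
theorem IsMaximalMonotone.mem_of_forall {T : H → Set H} (hT : IsMaximalMonotone T) {x u : H}
    (h : ∀ y, ∀ v ∈ T y, 0 ≤ ⟪x - y, u - v⟫_ℝ) : u ∈ T x := by
  have hmono : IsMonotone (fun z => T z ∪ {w | z = x ∧ w = u}) := by
    rintro y z a (ha | ⟨rfl, rfl⟩) b (hb | ⟨rfl, rfl⟩)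
    · exact hT.1 y z a ha b hb
    · rw [← neg_sub, ← neg_sub b a, inner_neg_neg]
      exact h y a ha
    · exact h z b hb
    · simp
  exact hT.2 hmono (fun z w hw => Or.inl hw) x (Or.inr ⟨rfl, rfl⟩)

theorem IsMaximalMonotone.exists_inner_neg {T : H → Set H} (hT : IsMaximalMonotone T) {x u : H}
    (h : u ∉ T x) : ∃ y, ∃ v ∈ T y, ⟪x - y, u - v⟫_ℝ < 0 := by
  contrapose! h
  exact hT.mem_of_forall h

theorem IsMaximalMonotone.translate {T : H → Set H} (hT : IsMaximalMonotone T) (v : H) :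
    IsMaximalMonotone (fun x => T (x + v)) := by
  refine ⟨fun x y a ha b hb => by simpa using hT.1 _ _ a ha b hb, fun S hS hle x u hu => ?_⟩
  refine hT.mem_of_forall fun y w hw => ?_
  have := hS x (y - v) u hu w (hle (y - v) (by simpa using hw))
  rwa [show x + v - y = x - (y - v) by abel]

section PosDef

variable {D : H ≃L[ℝ] H}

theorem IsSelfAdjointPosDef.inner_comm (hD : IsSelfAdjointPosDef (D : H →L[ℝ] H))
    (x y : H) : ⟪D x, y⟫_ℝ = ⟪x, D y⟫_ℝ := hD.1 x y

theorem IsSelfAdjointPosDef.inner_nonneg (hD : IsSelfAdjointPosDef (D : H →L[ℝ] H))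
    (x : H) : 0 ≤ ⟪D x, x⟫_ℝ := by
  rcases eq_or_ne x 0 with rfl | hx
  · simp
  · exact (hD.2 x hx).le

theorem IsSelfAdjointPosDef.symm (hD : IsSelfAdjointPosDef (D : H →L[ℝ] H)) :
    IsSelfAdjointPosDef (D.symm : H →L[ℝ] H) := by
  refine ⟨fun x y => ?_, fun x hx => ?_⟩
  · have := hD.inner_comm (D.symm x) (D.symm y)
    simpa using this.symm
  · have := hD.2 (D.symm x) (by simpa using hx)
    rw [real_inner_comm] at this
    simpa using this

/-- The inverse `D⁻¹` of a positive operator is coercive with constant `‖D‖⁻¹`. -/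
theorem IsSelfAdjointPosDef.norm_sq_le (hD : IsSelfAdjointPosDef (D : H →L[ℝ] H))
    {C : ℝ} (hC : 0 < C) (hDC : ‖(D : H →L[ℝ] H)‖ ≤ C) (x : H) :
    ‖x‖ ^ 2 ≤ C * ⟪D.symm x, x⟫_ℝ := by
  -- Expanding this square in the `D`-form gives the bound without a square root of `D`.
  have h := hD.inner_nonneg (D.symm x - C⁻¹ • x)
  have hx : ⟪D x, x⟫_ℝ ≤ C * ‖x‖ ^ 2 := by
    calc ⟪D x, x⟫_ℝ ≤ ‖D x‖ * ‖x‖ := real_inner_le_norm _ _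
      _ ≤ (C * ‖x‖) * ‖x‖ := by gcongr; exact (D : H →L[ℝ] H).le_of_opNorm_le hDC x
      _ = _ := by ring
  simp only [map_sub, map_smul, inner_sub_left, inner_sub_right, inner_smul_left, inner_smul_right,
    ContinuousLinearEquiv.apply_symm_apply, real_inner_self_eq_norm_sq, conj_trivial,
    hD.inner_comm x (D.symm x)] at h
  rw [real_inner_comm]
  have h2 : C⁻¹ * (C⁻¹ * ⟪D x, x⟫_ℝ) ≤ C⁻¹ * ‖x‖ ^ 2 := by
    gcongr
    rwa [inv_mul_le_iff₀ hC]
  have h3 : C⁻¹ * ‖x‖ ^ 2 ≤ ⟪x, D.symm x⟫_ℝ := by linarith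
  rwa [inv_mul_le_iff₀ hC] at h3

theorem IsSelfAdjointPosDef.exists_coercive (hD : IsSelfAdjointPosDef (D : H →L[ℝ] H)) :
    ∃ c > 0, ∀ x, c * ‖x‖ ^ 2 ≤ ⟪D.symm x, x⟫_ℝ := by
  refine ⟨(‖(D : H →L[ℝ] H)‖ + 1)⁻¹, by positivity, fun x => ?_⟩
  rw [inv_mul_le_iff₀ (by positivity)]
  exact hD.norm_sq_le (by positivity) (by linarith) x

/-- **Minty's theorem** in the metric induced by `D⁻¹`, by minimizing the sum of the Fitzpatrick
function of `T` and the quadratic form `(x, u) ↦ (⟪D⁻¹ x, x⟫ + ⟪D u, u⟫) / 2`. -/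
theorem IsMaximalMonotone.exists_neg_symm_mem [CompleteSpace H]
    (hD : IsSelfAdjointPosDef (D : H →L[ℝ] H)) {T : H → Set H} (hT : IsMaximalMonotone T) :
    ∃ x, -(D.symm x) ∈ T x := by
  obtain ⟨c₁, hc₁, h₁⟩ := hD.exists_coercive
  obtain ⟨c₂, hc₂, h₂⟩ := hD.symm.exists_coercive
  simp only [ContinuousLinearEquiv.symm_symm] at h₂
  have hsymm := hD.symm.inner_comm
  have hgraph : ∃ y, ∃ v, v ∈ T y := by
    by_contra! hcon
    exact hcon 0 0 (hT.mem_of_forall fun y v hv => absurd hv (hcon y v))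
  let Q : H × H → ℝ := fun z => (⟪D.symm z.1, z.1⟫_ℝ + ⟪D z.2, z.2⟫_ℝ) / 2
  -- The supremum of the `ℓ i` is the Fitzpatrick function: at least `⟪x, u⟫` everywhere, with
  -- equality on the graph.
  let ℓ : {a : H × H // a.2 ∈ T a.1} → H × H → ℝ :=
    fun a z => ⟪z.1, a.1.2⟫_ℝ + ⟪a.1.1, z.2⟫_ℝ - ⟪a.1.1, a.1.2⟫_ℝ
  have hself : ∀ y v, v ∈ T y → ∀ i, ℓ i (y, v) + Q (y, v) ≤ ⟪y, v⟫_ℝ + Q (y, v) := by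
    rintro y v hv ⟨⟨y', v'⟩, hv'⟩
    have := hT.1 y y' v hv v' hv'
    simp only [inner_sub_left, inner_sub_right] at this
    simp only [ℓ]
    linarith
  have hsq : ∀ x u : H, ⟪D.symm (x + D u), x + D u⟫_ℝ
      = ⟪D.symm x, x⟫_ℝ + 2 * ⟪x, u⟫_ℝ + ⟪D u, u⟫_ℝ := by
    intro x u
    simp only [map_add, ContinuousLinearEquiv.symm_apply_apply, inner_add_left, inner_add_right,
      hsymm x (D u), real_inner_comm x u, real_inner_comm u (D u)]
    ring
  obtain ⟨⟨x₀, u₀⟩, h₀⟩ := exists_quadratic_growth_point ℓ Q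
    (fun i => by simp only [ℓ]; fun_prop) (by simp only [Q]; fun_prop)
    (fun i a b t => by
      simp only [ℓ, Prod.fst_add, Prod.snd_add, Prod.smul_fst, Prod.smul_snd, Prod.fst_sub,
        Prod.snd_sub, inner_add_left, inner_add_right, inner_smul_left, inner_smul_right,
        inner_sub_left, inner_sub_right, conj_trivial]
      ring)
    (fun a b t => by
      simp only [Q, Prod.fst_add, Prod.snd_add, Prod.smul_fst, Prod.smul_snd, Prod.fst_sub,
        Prod.snd_sub, inner_add_left, inner_add_right, inner_smul_left, inner_smul_right,
        inner_sub_left, inner_sub_right, conj_trivial, map_add, map_sub, map_smul]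
      ring)
    (c := min c₁ c₂ / 2) (by positivity)
    (fun z => by
      have e1 := h₁ z.1
      have e2 := h₂ z.2
      have e3 : min c₁ c₂ * ‖z.1‖ ^ 2 ≤ c₁ * ‖z.1‖ ^ 2 := by gcongr; exact min_le_left _ _
      have e4 : min c₁ c₂ * ‖z.2‖ ^ 2 ≤ c₂ * ‖z.2‖ ^ 2 := by gcongr; exact min_le_right _ _
      have e5 : 0 ≤ min c₁ c₂ * ‖z.1‖ ^ 2 := by positivity
      have e6 : 0 ≤ min c₁ c₂ * ‖z.2‖ ^ 2 := by positivity
      simp only [Q]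
      rcases max_choice ‖z.1‖ ‖z.2‖ with h | h <;> rw [Prod.norm_def, h] <;> linarith)
    (by
      obtain ⟨y, v, hv⟩ := hgraph
      exact ⟨_, _, hself y v hv⟩)
    (by
      rintro s ⟨x, u⟩ hs
      have hn := hD.symm.inner_nonneg (x + D u)
      rw [hsq] at hn
      have : ∃ i, ⟪x, u⟫_ℝ ≤ ℓ i (x, u) := by
        by_cases hu : u ∈ T x
        · exact ⟨⟨(x, u), hu⟩, by simp [ℓ]⟩
        · obtain ⟨y, v, hv, hlt⟩ := hT.exists_inner_neg hu
          refine ⟨⟨(y, v), hv⟩, ?_⟩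
          simp only [inner_sub_left, inner_sub_right] at hlt
          simp only [ℓ]
          linarith
      obtain ⟨i, hi⟩ := this
      have := hs i
      simp only [Q] at this
      linarith)
  have hn := hD.symm.inner_nonneg (x₀ + D u₀)
  -- Quadratic growth tested at graph points makes `(-D u₀, -D⁻¹ x₀)` monotonically related to `T`,
  -- hence a graph point. Testing it against itself then forces `x₀ + D u₀ = 0`.
  have hbase : ∀ y, ∀ v ∈ T y, ⟪D.symm (x₀ + D u₀), x₀ + D u₀⟫_ℝ / 2
      ≤ ⟪-(D u₀) - y, -(D.symm x₀) - v⟫_ℝ := by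
    intro y v hv
    have := h₀ _ _ (hself y v hv)
    simp only [Q, Prod.fst_sub, Prod.snd_sub, map_sub, inner_sub_left, inner_sub_right] at this
    rw [hsq]
    have e := hD.inner_comm u₀ (D.symm x₀)
    simp only [ContinuousLinearEquiv.apply_symm_apply] at e
    simp only [inner_sub_left, inner_sub_right, inner_neg_left, inner_neg_right]
    linarith [hsymm y x₀, hD.inner_comm v u₀, real_inner_comm x₀ u₀, real_inner_comm y (D.symm x₀),
      real_inner_comm v (D u₀), real_inner_comm x₀ (D.symm y), hsymm x₀ y, hD.inner_comm u₀ v,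
      real_inner_comm u₀ (D v), real_inner_comm (D u₀) v, real_inner_comm (D.symm x₀) y]
  have hmem : -(D.symm x₀) ∈ T (-(D u₀)) :=
    hT.mem_of_forall fun y v hv => by
      have := hbase y v hv
      have hn' : 0 ≤ ⟪D.symm (x₀ + D u₀), x₀ + D u₀⟫_ℝ := hn
      linarith
  have hle := hbase _ _ hmem
  rw [sub_self, inner_zero_left] at hle
  have hzero : x₀ + D u₀ = 0 := by
    by_contra hne
    have : 0 < ⟪D.symm (x₀ + D u₀), x₀ + D u₀⟫_ℝ := hD.symm.2 _ hne
    linarith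
  refine ⟨x₀, ?_⟩
  rwa [← eq_neg_of_add_eq_zero_left hzero] at hmem

theorem mem_resolvent_precond_iff {T : H → Set H} {v p : H} :
    p ∈ resolvent (precond (D : H →L[ℝ] H) T) v ↔ D.symm (v - p) ∈ T p := by
  simp only [resolvent, inverse, ident, precond, Set.mem_ofPred_eq, Pi.add_apply,
    Set.singleton_add, Set.mem_image]
  constructor
  · rintro ⟨_, ⟨u, hu, rfl⟩, rfl⟩
    simpa using hu
  · intro h
    exact ⟨_, ⟨_, h, rfl⟩, by simp⟩

/-- Existence is Minty's theorem for `T` translated by `v`; uniqueness is monotonicity against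
positivity of `D⁻¹`. -/
theorem IsMaximalMonotone.exists_resolvent_eq_singleton [CompleteSpace H]
    (hD : IsSelfAdjointPosDef (D : H →L[ℝ] H)) {T : H → Set H}
    (hT : IsMaximalMonotone T) (v : H) :
    ∃ p, resolvent (precond (D : H →L[ℝ] H) T) v = {p} := by
  obtain ⟨x, hx⟩ := IsMaximalMonotone.exists_neg_symm_mem hD (hT.translate v)
  refine ⟨x + v, Set.eq_singleton_iff_unique_mem.2 ⟨?_, fun p hp => ?_⟩⟩
  · rw [mem_resolvent_precond_iff]
    simpa using hx
  · rw [mem_resolvent_precond_iff] at hp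
    have h := hT.1 _ _ _ hp _ hx
    have e : D.symm (v - p) - -(D.symm x) = -(D.symm (p - (x + v))) := by
      rw [← map_neg, ← map_sub, ← map_neg]; congr 1; abel
    rw [e, inner_neg_right, real_inner_comm] at h
    by_contra hne
    have : 0 < ⟪D.symm (p - (x + v)), p - (x + v)⟫_ℝ := hD.symm.2 _ (sub_ne_zero.2 hne)
    linarith

end PosDef

/-! ### Quasi-Fejér estimates -/

/-- Quasi-Fejér sequences converge, and their decrements vanish. -/
theorem tendsto_of_le_one_add_mul_sub {W r δ : ℕ → ℝ} {K : ℝ} (hW : ∀ k, 0 ≤ W k)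
    (hr : ∀ k, 0 ≤ r k) (hs : Summable δ)
    (h : ∀ k, W (k + 1) ≤ (1 + K * δ k) * W k - r k) :
    (∃ L, Tendsto W atTop (𝓝 L)) ∧ Tendsto r atTop (𝓝 0) := by
  -- `P` dominates the growth factors through `1 + t ≤ exp t`, so `W / P` is antitone.
  let P : ℕ → ℝ := fun k => Real.exp (K * ∑ i ∈ Finset.range k, δ i)
  have hP : Tendsto P atTop (𝓝 (Real.exp (K * ∑' i, δ i))) :=
    (Real.continuous_exp.tendsto _).comp (hs.hasSum.tendsto_sum_nat.const_mul K)
  have hPpos : ∀ k, 0 < P k := fun k => Real.exp_pos _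
  have hPs : ∀ k, P (k + 1) = Real.exp (K * δ k) * P k := by
    intro k
    simp only [P, Finset.sum_range_succ, mul_add, Real.exp_add]
    ring
  have hanti : Antitone fun k => W k / P k := by
    refine antitone_nat_of_succ_le fun k => ?_
    rw [div_le_div_iff₀ (hPpos _) (hPpos _), hPs]
    have h1 : W (k + 1) ≤ Real.exp (K * δ k) * W k := by
      have := Real.add_one_le_exp (K * δ k)
      nlinarith [h k, hr k, hW k]
    nlinarith [hPpos k]
  have hlim : ∃ L, Tendsto (fun k => W k / P k) atTop (𝓝 L) :=
    ⟨_, tendsto_atTop_ciInf hanti ⟨0, by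
      rintro _ ⟨k, rfl⟩
      exact div_nonneg (hW k) (hPpos k).le⟩⟩
  obtain ⟨L, hL⟩ := hlim
  have hWL : Tendsto W atTop (𝓝 (L * Real.exp (K * ∑' i, δ i))) := by
    refine (hL.mul hP).congr fun k => ?_
    have := (hPpos k).ne'
    field_simp
  refine ⟨⟨_, hWL⟩, ?_⟩
  have hup : Tendsto (fun k => (1 + K * δ k) * W k - W (k + 1)) atTop (𝓝 0) := by
    have h1 := (((hs.tendsto_atTop_zero.const_mul K).const_add 1).mul hWL).sub
      (hWL.comp (tendsto_add_atTop_nat 1))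
    simpa using h1
  exact squeeze_zero hr (fun k => by linarith [h k]) hup

/-- Effect of changing the metric from `D⁻¹` to `D'⁻¹` and shifting by `(D' - D) u`. -/
theorem exists_inner_symm_sub_le (C : ℝ) (hC : 1 ≤ C) (u : H) :
    ∃ K : ℝ, 0 ≤ K ∧ ∀ D D' : H ≃L[ℝ] H, IsSelfAdjointPosDef (D : H →L[ℝ] H) →
      ‖(D : H →L[ℝ] H)‖ ≤ C → ‖(D' : H →L[ℝ] H)‖ ≤ C →
      ‖(D.symm : H →L[ℝ] H)‖ ≤ C → ‖(D'.symm : H →L[ℝ] H)‖ ≤ C → ∀ e : H,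
      ⟪D'.symm (e - (D' u - D u)), e - (D' u - D u)⟫_ℝ ≤ ⟪D.symm e, e⟫_ℝ +
        K * ‖(D' : H →L[ℝ] H) - (D : H →L[ℝ] H)‖ * (⟪D.symm e, e⟫_ℝ + 1) := by
  set n := ‖u‖ with hn
  have hn0 : 0 ≤ n := norm_nonneg u
  -- The sum of the coefficients of `q` and of the constant terms in `t1`, `t2`, `t3` below.
  refine ⟨2 * C ^ 3 + 8 * C ^ 4 * n ^ 2 + C ^ 2 + C * n ^ 2 + 2 * C ^ 2 * n ^ 2, by positivity,
    fun D D' hD hDC hDC' hMC hMC' e => ?_⟩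
  set δ := ‖(D' : H →L[ℝ] H) - (D : H →L[ℝ] H)‖ with hδ
  have hδ0 : 0 ≤ δ := norm_nonneg _
  have hC0 : 0 < C := by linarith
  have hδC : δ ≤ 2 * C := (norm_sub_le _ _).trans (by linarith)
  set s := D' u - D u with hs
  set d := e - s with hd
  set q := ⟪D.symm e, e⟫_ℝ with hq
  have hq0 : 0 ≤ q := hD.symm.inner_nonneg e
  have hop : ∀ y, ‖D' y - D y‖ ≤ δ * ‖y‖ := fun y =>
    ((D' : H →L[ℝ] H) - (D : H →L[ℝ] H)).le_opNorm y
  have hM : ∀ y, ‖D.symm y‖ ≤ C * ‖y‖ := fun y => (D.symm : H →L[ℝ] H).le_of_opNorm_le hMC y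
  have hM' : ∀ y, ‖D'.symm y‖ ≤ C * ‖y‖ := fun y => (D'.symm : H →L[ℝ] H).le_of_opNorm_le hMC' y
  have hsn : ‖s‖ ≤ δ * n := hop u
  have he : ‖e‖ ^ 2 ≤ C * q := hD.norm_sq_le hC0 hDC e
  -- One factor `δ` is traded for `2 * C`, keeping the error linear in `δ`.
  have hs2 : ‖s‖ ^ 2 ≤ 2 * C * δ * n ^ 2 := by
    calc ‖s‖ ^ 2 ≤ (δ * n) ^ 2 := by gcongr
      _ = δ * δ * n ^ 2 := by ring
      _ ≤ 2 * C * δ * n ^ 2 := by gcongr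
  have hs3 : ‖s‖ ^ 2 ≤ 4 * C ^ 2 * n ^ 2 := by
    calc ‖s‖ ^ 2 ≤ 2 * C * δ * n ^ 2 := hs2
      _ ≤ 2 * C * (2 * C) * n ^ 2 := by gcongr
      _ = _ := by ring
  have hd2 : ‖d‖ ^ 2 ≤ 2 * C * q + 8 * C ^ 2 * n ^ 2 := by
    have h1 : ‖d‖ ≤ ‖e‖ + ‖s‖ := norm_sub_le _ _
    have h2 : ‖d‖ ^ 2 ≤ (‖e‖ + ‖s‖) ^ 2 := by gcongr
    nlinarith [sq_nonneg (‖e‖ - ‖s‖)]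
  have t1 : ⟪D'.symm d - D.symm d, d⟫_ℝ ≤ C ^ 2 * δ * (2 * C * q + 8 * C ^ 2 * n ^ 2) := by
    have h1 : D'.symm d - D.symm d = -(D'.symm (D' (D.symm d) - D (D.symm d))) := by simp
    have h2 : ‖D'.symm d - D.symm d‖ ≤ C * (δ * (C * ‖d‖)) := by
      rw [h1, norm_neg]
      refine (hM' _).trans ?_
      gcongr
      exact (hop _).trans (by gcongr; exact hM d)
    calc ⟪D'.symm d - D.symm d, d⟫_ℝ ≤ ‖D'.symm d - D.symm d‖ * ‖d‖ := real_inner_le_norm _ _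
      _ ≤ C * (δ * (C * ‖d‖)) * ‖d‖ := by gcongr
      _ = C ^ 2 * δ * ‖d‖ ^ 2 := by ring
      _ ≤ _ := by gcongr
  have t2 : -(2 * ⟪D.symm e, s⟫_ℝ) ≤ C * δ * (C * q + n ^ 2) := by
    have h1 : -⟪D.symm e, s⟫_ℝ ≤ C * ‖e‖ * (δ * n) := by
      calc -⟪D.symm e, s⟫_ℝ ≤ |⟪D.symm e, s⟫_ℝ| := neg_le_abs _
        _ ≤ ‖D.symm e‖ * ‖s‖ := abs_real_inner_le_norm _ _
        _ ≤ C * ‖e‖ * (δ * n) := by gcongr; exact hM e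
    calc -(2 * ⟪D.symm e, s⟫_ℝ) ≤ C * δ * (2 * ‖e‖ * n) := by linarith
      _ ≤ C * δ * (C * q + n ^ 2) := by
        gcongr
        linarith [two_mul_le_add_sq ‖e‖ n]
  have t3 : ⟪D.symm s, s⟫_ℝ ≤ C * (2 * C * δ * n ^ 2) := by
    calc ⟪D.symm s, s⟫_ℝ ≤ ‖D.symm s‖ * ‖s‖ := real_inner_le_norm _ _
      _ ≤ C * ‖s‖ * ‖s‖ := by gcongr; exact hM s
      _ = C * ‖s‖ ^ 2 := by ring
      _ ≤ _ := by gcongr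
  have hsplit : ⟪D'.symm d, d⟫_ℝ = ⟪D'.symm d - D.symm d, d⟫_ℝ + q - 2 * ⟪D.symm e, s⟫_ℝ
      + ⟪D.symm s, s⟫_ℝ := by
    have h1 : ⟪D.symm s, e⟫_ℝ = ⟪D.symm e, s⟫_ℝ := by
      rw [hD.symm.inner_comm, real_inner_comm]
    have h2 : ⟪D.symm d, d⟫_ℝ = q - 2 * ⟪D.symm e, s⟫_ℝ + ⟪D.symm s, s⟫_ℝ := by
      rw [hd]
      simp only [map_sub, inner_sub_left, inner_sub_right, h1]
      ring
    rw [inner_sub_left, h2]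
    ring
  rw [hsplit]
  have hpos : 0 ≤ δ * (8 * C ^ 4 * n ^ 2 + C * n ^ 2 + 2 * C ^ 2 * n ^ 2) * q := by positivity
  have hpos' : 0 ≤ δ * (2 * C ^ 3 + C ^ 2) := by positivity
  linarith

/-- Fejér monotonicity of one Douglas–Rachford step in the metric induced by `D⁻¹`. -/
theorem IsMonotone.inner_symm_douglasRachford_le {A B : H → Set H} (hA : IsMonotone A)
    (hB : IsMonotone B) {D : H ≃L[ℝ] H} (hD : IsSelfAdjointPosDef (D : H →L[ℝ] H))
    {x u p a q b : H} (hu : u ∈ A x) (hu' : -u ∈ B x) (ha : a ∈ A p) (hb : b ∈ B q)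
    (hpq : p - q = D (a + b)) :
    ⟪D.symm (p + D a + q - p - (x + D u)), p + D a + q - p - (x + D u)⟫_ℝ ≤
      ⟪D.symm (p + D a - (x + D u)), p + D a - (x + D u)⟫_ℝ - ⟪D.symm (p - q), p - q⟫_ℝ := by
  have h1 := hA p x a ha u hu
  have h2 := hB q x b hb (-u) hu'
  set d := p + D a - (x + D u) with hd
  have he : p + D a + q - p - (x + D u) = d - (p - q) := by rw [hd]; abel
  have hMpq : D.symm (p - q) = a + b := by rw [hpq]; simp
  have hMd : D.symm d = D.symm (p - x) + (a - u) := by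
    rw [hd, show p + D a - (x + D u) = (p - x) + D (a - u) by rw [map_sub]; abel]
    simp
  have h3 : ⟪a + b, d⟫_ℝ = ⟪D.symm d, p - q⟫_ℝ := by
    rw [← hMpq, hD.symm.inner_comm, real_inner_comm]
  have h4 : ⟪D.symm d, p - q⟫_ℝ = ⟪p - x, a + b⟫_ℝ + ⟪a - u, p - q⟫_ℝ := by
    rw [hMd, inner_add_left, hD.symm.inner_comm, hMpq]
  -- The slack in the Fejér inequality is, up to a factor `2`, exactly the sum of the two
  -- monotonicity products.
  have h5 : ⟪p - x, a + b⟫_ℝ + ⟪a - u, p - q⟫_ℝ - ⟪a + b, p - q⟫_ℝ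
      = ⟪p - x, a - u⟫_ℝ + ⟪q - x, b - -u⟫_ℝ := by
    have e1 : ⟪a - u, p - q⟫_ℝ = ⟪p - q, a - u⟫_ℝ := real_inner_comm _ _
    have e2 : ⟪a + b, p - q⟫_ℝ = ⟪p - q, a + b⟫_ℝ := real_inner_comm _ _
    rw [e1, e2]
    simp only [inner_add_right, inner_sub_left, inner_sub_right, inner_neg_right]
    ring
  rw [he, map_sub, hMpq]
  simp only [inner_sub_left (D.symm d), inner_sub_right _ d] at *
  linarith

/-! ### Weak convergence and closedness -/

variable {α : Type*}

/-- Weak convergence, expressed through inner products. -/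
def WeaklyTendsto (f : α → H) (F : Filter α) (x : H) : Prop :=
  ∀ y, Tendsto (fun k => ⟪y, f k⟫_ℝ) F (𝓝 ⟪y, x⟫_ℝ)

/-- Weak against strong convergence. Along a general filter weak convergence does not give
boundedness, hence `hR`. -/
theorem WeaklyTendsto.tendsto_inner {f g : α → H} {F : Filter α} {x y : H} {R : ℝ}
    (hf : WeaklyTendsto f F x) (hR : ∀ k, ‖f k‖ ≤ R) (hg : Tendsto g F (𝓝 y)) :
    Tendsto (fun k => ⟪g k, f k⟫_ℝ) F (𝓝 ⟪y, x⟫_ℝ) := by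
  have h1 : Tendsto (fun k => ⟪g k - y, f k⟫_ℝ) F (𝓝 0) := by
    have h2 : Tendsto (fun k => ‖g k - y‖ * R) F (𝓝 0) := by
      simpa using (tendsto_iff_norm_sub_tendsto_zero.1 hg).mul_const R
    refine squeeze_zero_norm (fun k => ?_) h2
    exact (norm_inner_le_norm _ _).trans (by gcongr; exact hR k)
  refine (by simpa using h1.add (hf y) : Tendsto _ F (𝓝 ⟪y, x⟫_ℝ)).congr fun k => ?_
  rw [inner_sub_left]; ring

theorem WeaklyTendsto.add_of_tendsto_zero {f g : α → H} {F : Filter α} {x : H}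
    (hf : WeaklyTendsto f F x) (hg : Tendsto g F (𝓝 0)) :
    WeaklyTendsto (fun k => f k + g k) F x := by
  intro y
  have h : Tendsto (fun k => ⟪y, g k⟫_ℝ) F (𝓝 0) := by
    simpa using (tendsto_const_nhds (x := y)).inner (𝕜 := ℝ) hg
  simpa [inner_add_right] using (hf y).add h

theorem WeaklyTendsto.neg {f : α → H} {F : Filter α} {x : H} (hf : WeaklyTendsto f F x) :
    WeaklyTendsto (fun k => -f k) F (-x) := by
  intro y
  simpa using (hf y).neg

/-- Banach–Alaoglu, carried over by the Riesz isomorphism. -/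
theorem exists_weaklyTendsto [CompleteSpace H] (U : Ultrafilter α) {f : α → H} {R : ℝ}
    (hR : ∀ k, ‖f k‖ ≤ R) : ∃ x, WeaklyTendsto f U x := by
  let φ : α → WeakDual ℝ H := fun k =>
    StrongDual.toWeakDual (InnerProductSpace.toDual ℝ H (f k))
  have hc := WeakDual.isCompact_closedBall (𝕜 := ℝ) (E := H) 0 R
  obtain ⟨ψ, -, hψ⟩ := hc.ultrafilter_le_nhds (U.map φ) (by
    rw [le_principal_iff]
    refine Filter.mem_map.2 (Filter.univ_mem' fun k => ?_)
    simp only [φ, Set.mem_preimage, Metric.mem_closedBall, dist_zero_right]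
    exact ((InnerProductSpace.toDual ℝ H).norm_map (f k)).trans_le (hR k))
  refine ⟨(InnerProductSpace.toDual ℝ H).symm (WeakDual.toStrongDual ψ), fun y => ?_⟩
  have h : Tendsto (fun k => φ k y) U (𝓝 (ψ y)) :=
    ((WeakDual.eval_continuous y).tendsto ψ).comp hψ
  rw [real_inner_comm, InnerProductSpace.toDual_symm_apply]
  refine h.congr fun k => ?_
  rw [real_inner_comm]
  exact InnerProductSpace.toDual_apply_apply ..

theorem weaklyTendsto_iff_toWeakSpace [CompleteSpace H] {f : α → H} {F : Filter α} {x : H} :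
    WeaklyTendsto f F x ↔
      Tendsto (fun k => toWeakSpace ℝ H (f k)) F (𝓝 (toWeakSpace ℝ H x)) := by
  refine Iff.trans ?_ (WeakBilin.tendsto_iff_forall_eval_tendsto (topDualPairing ℝ H).flip
    (fun a b hab => by
      refine ext_inner_left ℝ fun y => ?_
      exact LinearMap.congr_fun hab (InnerProductSpace.toDual ℝ H y))).symm
  constructor
  · intro h g
    have := h ((InnerProductSpace.toDual ℝ H).symm g)
    simp only [InnerProductSpace.toDual_symm_apply] at this
    exact this
  · intro h y
    exact h (InnerProductSpace.toDual ℝ H y)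

/-- Weak-strong closedness of a pair of maximal monotone operators. -/
theorem IsMaximalMonotone.mem_and_neg_mem_of_weaklyTendsto {A B : H → Set H}
    (hA : IsMaximalMonotone A) (hB : IsMaximalMonotone B) {F : Filter α} [F.NeBot]
    {p a q b : α → H} {x u : H} {R : ℝ} (ha : ∀ k, a k ∈ A (p k)) (hb : ∀ k, b k ∈ B (q k))
    (hp : WeaklyTendsto p F x) (hau : WeaklyTendsto a F u)
    (hpq : Tendsto (fun k => p k - q k) F (𝓝 0)) (hab : Tendsto (fun k => a k + b k) F (𝓝 0))
    (hpR : ∀ k, ‖p k‖ ≤ R) (haR : ∀ k, ‖a k‖ ≤ R) : u ∈ A x ∧ -u ∈ B x := by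
  have hq : WeaklyTendsto q F x := by
    have := hp.add_of_tendsto_zero (by simpa using hpq.neg)
    simpa using this
  have hbu : WeaklyTendsto b F (-u) := by
    have := hau.neg.add_of_tendsto_zero hab
    simpa using this
  have h1 : Tendsto (fun k => ⟪p k - q k, a k⟫_ℝ) F (𝓝 0) := by
    simpa using hau.tendsto_inner haR hpq
  have h2 : Tendsto (fun k => ⟪a k + b k, p k⟫_ℝ) F (𝓝 0) := by
    simpa using hp.tendsto_inner hpR hab
  have h3 : Tendsto (fun k => ⟪p k - q k, a k + b k⟫_ℝ) F (𝓝 0) := by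
    simpa using hpq.inner (𝕜 := ℝ) hab
  -- Neither product need converge alone; the sum equals `⟪p - q, a⟫ + ⟪a + b, p⟫ - ⟪p - q, a + b⟫`.
  have hcross : Tendsto (fun k => ⟪p k, a k⟫_ℝ + ⟪q k, b k⟫_ℝ) F (𝓝 0) := by
    refine (by simpa using (h1.add h2).sub h3 : Tendsto _ F (𝓝 (0 : ℝ))).congr fun k => ?_
    rw [real_inner_comm (p k)]
    simp only [inner_sub_left, inner_add_right]
    ring
  have hsum : ∀ y, ∀ v ∈ A y, ∀ z, ∀ t ∈ B z, 0 ≤ ⟪x - y, u - v⟫_ℝ + ⟪x - z, -u - t⟫_ℝ := by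
    intro y v hv z t ht
    have hlim : Tendsto (fun k => ⟪p k - y, a k - v⟫_ℝ + ⟪q k - z, b k - t⟫_ℝ) F
        (𝓝 (0 - ⟪v, x⟫_ℝ - ⟪y, u⟫_ℝ + ⟪y, v⟫_ℝ - ⟪t, x⟫_ℝ - ⟪z, -u⟫_ℝ + ⟪z, t⟫_ℝ)) := by
      refine ((((((hcross.sub (hp v)).sub (hau y)).add_const _).sub (hq t)).sub
        (hbu z)).add_const _).congr fun k => ?_
      simp only [inner_sub_left, inner_sub_right, real_inner_comm (p k), real_inner_comm (q k)]
      ring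
    have h0 := ge_of_tendsto' hlim fun k =>
      add_nonneg (hA.1 _ _ _ (ha k) _ hv) (hB.1 _ _ _ (hb k) _ ht)
    simp only [inner_sub_left, inner_sub_right, inner_neg_right, real_inner_comm x] at h0 ⊢
    linarith
  -- A pair violating `u ∈ A x` would make the `B`-term in `hsum` positive throughout, so `-u ∈ B
  -- x`; but at `(x, -u)` that term is `0`.
  have huA : u ∈ A x := by
    by_contra hu
    obtain ⟨y, v, hv, hlt⟩ := hA.exists_inner_neg hu
    have hmem : -u ∈ B x := hB.mem_of_forall fun z t ht => by linarith [hsum y v hv z t ht]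
    have := hsum y v hv x _ hmem
    simp only [sub_self, inner_zero_left] at this
    linarith
  refine ⟨huA, hB.mem_of_forall fun z t ht => ?_⟩
  simpa using hsum x u huA z t ht

/-- The difference is `-(Δ k)⁻¹ (Δ k - Δlim) Δlim⁻¹ y`, with `(Δ k)⁻¹` uniformly bounded. -/
theorem tendsto_symm_apply {Δ : ℕ → H ≃L[ℝ] H} {Δlim : H ≃L[ℝ] H} {C : ℝ}
    (hlow : ∀ k, ‖((Δ k).symm : H →L[ℝ] H)‖ ≤ C)
    (hconv : Tendsto (fun k => (Δ k : H →L[ℝ] H)) atTop (𝓝 (Δlim : H →L[ℝ] H))) (y : H) :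
    Tendsto (fun k => (Δ k).symm y) atTop (𝓝 (Δlim.symm y)) := by
  have h1 : Tendsto (fun k => Δ k (Δlim.symm y)) atTop (𝓝 (Δlim (Δlim.symm y))) :=
    ((ContinuousLinearMap.apply ℝ H (Δlim.symm y)).continuous.tendsto _).comp hconv
  rw [tendsto_iff_norm_sub_tendsto_zero] at h1 ⊢
  refine squeeze_zero (fun _ => norm_nonneg _) (fun k => ?_)
    ((h1.const_mul C).mono_right (by rw [mul_zero]))
  have h2 : (Δ k).symm y - Δlim.symm y
      = -((Δ k).symm (Δ k (Δlim.symm y) - Δlim (Δlim.symm y))) := by simp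
  rw [h2, norm_neg]
  exact ((Δ k).symm : H →L[ℝ] H).le_of_opNorm_le (hlow k) _

/-! ### Convergence of the iteration -/

/-- The quantities controlled by quasi-Fejér monotonicity of the variable metric
Douglas–Rachford iteration with respect to the moving fixed points `x + Δ k u`. -/
theorem tendsto_douglasRachford_fejer {A B : H → Set H} (hA : IsMonotone A) (hB : IsMonotone B)
    {Δ : ℕ → H ≃L[ℝ] H} {C : ℝ} (hC : 1 ≤ C)
    (hup : ∀ k, ‖(Δ k : H →L[ℝ] H)‖ ≤ C) (hlow : ∀ k, ‖((Δ k).symm : H →L[ℝ] H)‖ ≤ C)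
    (hpos : ∀ k, IsSelfAdjointPosDef (Δ k : H →L[ℝ] H))
    (hsum : Summable fun k => ‖(Δ (k + 1) : H →L[ℝ] H) - (Δ k : H →L[ℝ] H)‖)
    {p q a b : ℕ → H} (ha : ∀ k, a k ∈ A (p k)) (hb : ∀ k, b k ∈ B (q k))
    (hpq : ∀ k, p k - q k = Δ k (a k + b k))
    (hw : ∀ k, p (k + 1) + Δ (k + 1) (a (k + 1)) = p k + Δ k (a k) + q k - p k)
    {x u : H} (hu : u ∈ A x) (hu' : -u ∈ B x) :
    (∃ L, Tendsto (fun k => ⟪(Δ k).symm (p k + Δ k (a k) - (x + Δ k u)),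
      p k + Δ k (a k) - (x + Δ k u)⟫_ℝ) atTop (𝓝 L)) ∧
    Tendsto (fun k => ⟪(Δ k).symm (p k - q k), p k - q k⟫_ℝ) atTop (𝓝 0) := by
  obtain ⟨K, hK, hstep⟩ := exists_inner_symm_sub_le C hC u
  set V : ℕ → ℝ := fun k => ⟪(Δ k).symm (p k + Δ k (a k) - (x + Δ k u)),
      p k + Δ k (a k) - (x + Δ k u)⟫_ℝ with hV
  have hV0 : ∀ k, 0 ≤ V k := fun k => (hpos k).symm.inner_nonneg _
  have hr0 : ∀ k, 0 ≤ ⟪(Δ k).symm (p k - q k), p k - q k⟫_ℝ := fun k =>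
    (hpos k).symm.inner_nonneg _
  -- Moving the fixed point costs an additive error; using `V + 1` turns it into a relative one.
  have h := tendsto_of_le_one_add_mul_sub (W := fun k => V k + 1) (K := K)
    (fun k => by linarith [hV0 k]) hr0 hsum (fun k => by
      have h1 := hA.inner_symm_douglasRachford_le hB (hpos k) hu hu' (ha k) (hb k) (hpq k)
      have h2 := hstep _ _ (hpos k) (hup k) (hup (k + 1)) (hlow k) (hlow (k + 1))
        (p k + Δ k (a k) + q k - p k - (x + Δ k u))
      have h3 : p k + Δ k (a k) + q k - p k - (x + Δ k u) - (Δ (k + 1) u - Δ k u)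
          = p (k + 1) + Δ (k + 1) (a (k + 1)) - (x + Δ (k + 1) u) := by
        rw [hw]; abel
      rw [h3] at h2
      set E := ⟪(Δ k).symm (p k + Δ k (a k) + q k - p k - (x + Δ k u)),
        p k + Δ k (a k) + q k - p k - (x + Δ k u)⟫_ℝ
      have h4 : K * ‖(Δ (k + 1) : H →L[ℝ] H) - (Δ k : H →L[ℝ] H)‖ * (E + 1) ≤
          K * ‖(Δ (k + 1) : H →L[ℝ] H) - (Δ k : H →L[ℝ] H)‖ * (V k + 1) := by
        gcongr
        have h5 : E ≤ V k - ⟪(Δ k).symm (p k - q k), p k - q k⟫_ℝ := h1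
        linarith [hr0 k]
      have h5 : E ≤ V k - ⟪(Δ k).symm (p k - q k), p k - q k⟫_ℝ := h1
      have h6 : V (k + 1) ≤ E + K * ‖(Δ (k + 1) : H →L[ℝ] H) - (Δ k : H →L[ℝ] H)‖ * (E + 1) := h2
      linarith)
  obtain ⟨⟨L, hL⟩, hr⟩ := h
  exact ⟨⟨L - 1, by simpa using hL.sub_const 1⟩, hr⟩

/-- Weak convergence of the shadow sequence, in terms of the points `p k`, `q k` of the
Douglas–Rachford iteration and the associated `a k ∈ A (p k)`, `b k ∈ B (q k)`. -/
theorem exists_weaklyTendsto_douglasRachford [CompleteSpace H] {A B : H → Set H}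
    (hA : IsMaximalMonotone A) (hB : IsMaximalMonotone B) (hzer : (zer (A + B)).Nonempty)
    {Δ : ℕ → H ≃L[ℝ] H} {Δlim : H ≃L[ℝ] H} {C : ℝ} (hC : 1 ≤ C)
    (hup : ∀ k, ‖(Δ k : H →L[ℝ] H)‖ ≤ C) (hlow : ∀ k, ‖((Δ k).symm : H →L[ℝ] H)‖ ≤ C)
    (hpos : ∀ k, IsSelfAdjointPosDef (Δ k : H →L[ℝ] H))
    (hposlim : IsSelfAdjointPosDef (Δlim : H →L[ℝ] H))
    (hconv : Tendsto (fun k => (Δ k : H →L[ℝ] H)) atTop (𝓝 (Δlim : H →L[ℝ] H)))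
    (hsum : Summable fun k => ‖(Δ (k + 1) : H →L[ℝ] H) - (Δ k : H →L[ℝ] H)‖)
    {p q a b : ℕ → H} (ha : ∀ k, a k ∈ A (p k)) (hb : ∀ k, b k ∈ B (q k))
    (hpq : ∀ k, p k - q k = Δ k (a k + b k))
    (hw : ∀ k, p (k + 1) + Δ (k + 1) (a (k + 1)) = p k + Δ k (a k) + q k - p k) :
    ∃ x ∈ zer (A + B), WeaklyTendsto p atTop x := by
  have hC0 : 0 < C := by linarith
  have hmem : ∀ {x : H}, x ∈ zer (A + B) ↔ ∃ u ∈ A x, -u ∈ B x := by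
    intro x
    simp only [zer, Set.mem_ofPred_eq, Pi.add_apply, Set.mem_add]
    constructor
    · rintro ⟨u, hu, v, hv, huv⟩
      exact ⟨u, hu, by rwa [neg_eq_of_add_eq_zero_right huv]⟩
    · rintro ⟨u, hu, hu'⟩
      exact ⟨u, hu, -u, hu', add_neg_cancel u⟩
  have hfejer := fun {x u : H} (hu : u ∈ A x) (hu' : -u ∈ B x) =>
    tendsto_douglasRachford_fejer hA.1 hB.1 hC hup hlow hpos hsum ha hb hpq hw hu hu'
  obtain ⟨x₀, hx₀⟩ := hzer
  obtain ⟨u₀, hu₀, hu₀'⟩ := hmem.1 hx₀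
  obtain ⟨⟨L₀, hL₀⟩, hr⟩ := hfejer hu₀ hu₀'
  have hpq0 : Tendsto (fun k => p k - q k) atTop (𝓝 0) := by
    rw [tendsto_zero_iff_norm_tendsto_zero]
    have h1 : Tendsto (fun k => ‖p k - q k‖ ^ 2) atTop (𝓝 0) :=
      squeeze_zero (fun _ => by positivity) (fun k => (hpos k).norm_sq_le hC0 (hup k) _)
        (by simpa using hr.const_mul C)
    simpa using h1.sqrt
  have hab0 : Tendsto (fun k => a k + b k) atTop (𝓝 0) := by
    rw [tendsto_zero_iff_norm_tendsto_zero] at hpq0 ⊢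
    refine squeeze_zero (fun _ => norm_nonneg _) (fun k => ?_) (by simpa using hpq0.const_mul C)
    have h1 : a k + b k = (Δ k).symm (p k - q k) := by rw [hpq]; simp
    rw [h1]
    exact ((Δ k).symm : H →L[ℝ] H).le_of_opNorm_le (hlow k) _
  obtain ⟨R₀, hR₀⟩ := hL₀.bddAbove_range
  have hbound : ∀ k, ‖p k - x₀‖ ^ 2 ≤ C * R₀ ∧ ‖a k - u₀‖ ^ 2 ≤ C * R₀ := by
    intro k
    have h1 := hR₀ ⟨k, rfl⟩
    have h2 := hA.1 _ _ _ (ha k) _ hu₀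
    -- The cross term is nonnegative by monotonicity of `A`, so the Fejér distance bounds both `p k`
    -- and `a k`.
    have h3 : ⟪(Δ k).symm (p k + Δ k (a k) - (x₀ + Δ k u₀)), p k + Δ k (a k) - (x₀ + Δ k u₀)⟫_ℝ
        = ⟪(Δ k).symm (p k - x₀), p k - x₀⟫_ℝ + 2 * ⟪p k - x₀, a k - u₀⟫_ℝ
          + ⟪Δ k (a k - u₀), a k - u₀⟫_ℝ := by
      rw [show p k + Δ k (a k) - (x₀ + Δ k u₀) = (p k - x₀) + Δ k (a k - u₀) by
        rw [map_sub]; abel]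
      rw [map_add, ContinuousLinearEquiv.symm_apply_apply, inner_add_left, inner_add_right,
        inner_add_right, (hpos k).symm.inner_comm (p k - x₀) (Δ k (a k - u₀)),
        ContinuousLinearEquiv.symm_apply_apply, real_inner_comm (p k - x₀) (a k - u₀),
        real_inner_comm (a k - u₀) (Δ k (a k - u₀))]
      ring
    have h4 := (hpos k).norm_sq_le hC0 (hup k) (p k - x₀)
    have h5 := (hpos k).symm.norm_sq_le hC0 (hlow k) (a k - u₀)
    have h6 := (hpos k).inner_nonneg (a k - u₀)
    have h7 := (hpos k).symm.inner_nonneg (p k - x₀)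
    simp only [h3] at h1
    simp only [ContinuousLinearEquiv.symm_symm] at h5
    have h7' : 0 ≤ ⟪(Δ k).symm (p k - x₀), p k - x₀⟫_ℝ := h7
    constructor
    · refine h4.trans ?_
      gcongr
      linarith
    · refine h5.trans ?_
      gcongr
      linarith
  obtain ⟨R, hpR, haR⟩ : ∃ R, (∀ k, ‖p k‖ ≤ R) ∧ ∀ k, ‖a k‖ ≤ R := by
    refine ⟨√(C * R₀) + ‖x₀‖ + ‖u₀‖, fun k => ?_, fun k => ?_⟩
    · have h1 := Real.le_sqrt_of_sq_le (hbound k).1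
      have h2 := norm_le_norm_sub_add (p k) x₀
      linarith [norm_nonneg u₀]
    · have h1 := Real.le_sqrt_of_sq_le (hbound k).2
      have h2 := norm_le_norm_sub_add (a k) u₀
      linarith [norm_nonneg x₀]
  have hcluster : ∀ U : Ultrafilter ℕ, (U : Filter ℕ) ≤ atTop → ∃ x u, u ∈ A x ∧ -u ∈ B x ∧
      WeaklyTendsto p U x ∧ WeaklyTendsto a U u := by
    intro U hU
    obtain ⟨x, hx⟩ := exists_weaklyTendsto U hpR
    obtain ⟨u, hu⟩ := exists_weaklyTendsto U haR
    obtain ⟨h1, h2⟩ := hA.mem_and_neg_mem_of_weaklyTendsto hB ha hb hx hu (hpq0.mono_left hU)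
      (hab0.mono_left hU) hpR haR
    exact ⟨x, u, h1, h2, hx, hu⟩
  have hΔ : ∀ y, Tendsto (fun k => Δ k y) atTop (𝓝 (Δlim y)) := fun y =>
    ((ContinuousLinearMap.apply ℝ H y).continuous.tendsto _).comp hconv
  have hM := tendsto_symm_apply hlow hconv
  have hweak : ∀ U : Ultrafilter ℕ, (U : Filter ℕ) ≤ atTop → ∀ {x u : H}, WeaklyTendsto p U x →
      WeaklyTendsto a U u → ∀ {g : ℕ → H} {y : H}, Tendsto g atTop (𝓝 y) →
      Tendsto (fun k => ⟪g k, p k + Δ k (a k)⟫_ℝ) U (𝓝 ⟪y, x + Δlim u⟫_ℝ) := by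
    intro U hU x u hx hu g y hg
    -- `a` converges only weakly, so `Δ k` is moved onto the strongly convergent `g`.
    have hΔg : Tendsto (fun k => Δ k (g k)) atTop (𝓝 (Δlim y)) :=
      (isBoundedBilinearMap_apply.continuous.tendsto ((Δlim : H →L[ℝ] H), y)).comp (hconv.prodMk_nhds hg)
    have h := (hx.tendsto_inner hpR (hg.mono_left hU)).add
      (hu.tendsto_inner haR (hΔg.mono_left hU))
    rw [inner_add_right, ← hposlim.inner_comm]
    refine h.congr fun k => ?_
    rw [inner_add_right, (hpos k).inner_comm]
  have hunique : ∀ {x u x' u' : H}, u ∈ A x → -u ∈ B x → u' ∈ A x' → -u' ∈ B x' →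
      ∀ U U' : Ultrafilter ℕ, (U : Filter ℕ) ≤ atTop → (U' : Filter ℕ) ≤ atTop →
      WeaklyTendsto p U x → WeaklyTendsto a U u → WeaklyTendsto p U' x' →
      WeaklyTendsto a U' u' → x = x' := by
    intro x u x' u' hu hnu hu' hnu' U U' hU hU' hpx hau hpx' hau'
    obtain ⟨L, hL⟩ := (hfejer hu hnu).1
    obtain ⟨L', hL'⟩ := (hfejer hu' hnu').1
    have hs : ∀ y v, Tendsto (fun k => (Δ k).symm (y + Δ k v)) atTop
        (𝓝 (Δlim.symm (y + Δlim v))) := by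
      intro y v
      simpa using (hM y).add_const v
    have hfix : ∀ y v, Tendsto (fun k => ⟪(Δ k).symm (y + Δ k v), y + Δ k v⟫_ℝ) atTop
        (𝓝 ⟪Δlim.symm (y + Δlim v), y + Δlim v⟫_ℝ) := fun y v =>
      (hs y v).inner ((hΔ v).const_add y)
    -- Opial's step: in the difference of the two Fejér distances the quadratic term in `w` cancels,
    -- leaving this product and convergent terms.
    obtain ⟨ℓ, hℓ⟩ : ∃ ℓ, Tendsto (fun k => ⟪(Δ k).symm (x - x' + Δ k (u - u')),
        p k + Δ k (a k)⟫_ℝ) atTop (𝓝 ℓ) := by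
      refine ⟨_, ((((hfix x u).sub (hfix x' u')).sub (hL.sub hL')).div_const 2).congr
        fun k => ?_⟩
      set w := p k + Δ k (a k)
      have e : x - x' + Δ k (u - u') = (x + Δ k u) - (x' + Δ k u') := by rw [map_sub]; abel
      rw [e]
      generalize x + Δ k u = z
      generalize x' + Δ k u' = z'
      simp only [map_sub (Δ k).symm, inner_sub_left, inner_sub_right]
      have e1 := (hpos k).symm.inner_comm w z
      have e2 := (hpos k).symm.inner_comm w z'
      rw [real_inner_comm] at e1 e2
      have e3 : ⟪(Δ k).symm w, z⟫_ℝ = ⟪(Δ k).symm z, w⟫_ℝ := by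
        rw [(hpos k).symm.inner_comm, real_inner_comm]
      have e4 : ⟪(Δ k).symm w, z'⟫_ℝ = ⟪(Δ k).symm z', w⟫_ℝ := by
        rw [(hpos k).symm.inner_comm, real_inner_comm]
      rw [e3, e4]
      ring
    have h1 := tendsto_nhds_unique (hweak U hU hpx hau (hs (x - x') (u - u')))
      (hℓ.mono_left hU)
    have h2 := tendsto_nhds_unique (hweak U' hU' hpx' hau' (hs (x - x') (u - u')))
      (hℓ.mono_left hU')
    -- Equal limits along `U` and `U'` make the `Δlim⁻¹`-form vanish at this vector.
    have h3 : x - x' + Δlim (u - u') = 0 := by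
      by_contra hne
      have := hposlim.symm.2 _ hne
      have e : x - x' + Δlim (u - u') = (x + Δlim u) - (x' + Δlim u') := by rw [map_sub]; abel
      nth_rewrite 2 [e] at this
      rw [inner_sub_right] at this
      simp only [ContinuousLinearEquiv.coe_coe] at this
      linarith
    -- Since `x - x' = -Δlim (u - u')`, monotonicity of `A` and positivity of `Δlim` force `u = u'`.
    have h4 := hA.1 _ _ _ hu _ hu'
    rw [eq_neg_of_add_eq_zero_left h3, inner_neg_left] at h4
    have h5 : u - u' = 0 := by
      by_contra hne
      have := hposlim.2 _ hne
      simp only [ContinuousLinearEquiv.coe_coe] at this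
      linarith
    rw [h5, map_zero, add_zero] at h3
    exact sub_eq_zero.1 h3
  have hU₀ : ((Ultrafilter.of atTop : Ultrafilter ℕ) : Filter ℕ) ≤ atTop := Ultrafilter.of_le _
  obtain ⟨x, u, hu, hnu, hpx, hau⟩ := hcluster _ hU₀
  refine ⟨x, hmem.2 ⟨u, hu, hnu⟩, fun y => ?_⟩
  rw [tendsto_iff_ultrafilter]
  intro U hU
  obtain ⟨x', u', hu', hnu', hpx', hau'⟩ := hcluster U hU
  rw [hunique hu hnu hu' hnu' _ U hU₀ hU hpx hau hpx' hau']
  exact hpx' y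

end SetValued

theorem proposition3p2 {H : Type*} [NormedAddCommGroup H] [InnerProductSpace ℝ H]
    [CompleteSpace H]
    (A B : H → Set H)
    (hA : SetValued.IsMaximalMonotone A) (hB : SetValued.IsMaximalMonotone B)
    (hzer : (SetValued.zer (A + B)).Nonempty)
    (Δ : ℕ → H ≃L[ℝ] H) (Δlim : H ≃L[ℝ] H)
    (Cup Clow : ℝ)
    (hup : ∀ k, ‖(Δ k : H →L[ℝ] H)‖ ≤ Cup)
    (hlow : ∀ k, ‖((Δ k).symm : H →L[ℝ] H)‖ ≤ Clow)
    (hpos : ∀ k, SetValued.IsSelfAdjointPosDef (Δ k : H →L[ℝ] H))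
    (hposlim : SetValued.IsSelfAdjointPosDef (Δlim : H →L[ℝ] H))
    (hconv : Tendsto (fun k => (Δ k : H →L[ℝ] H)) atTop (𝓝 (Δlim : H →L[ℝ] H)))
    (hsum : Summable fun k => ‖(Δ (k + 1) : H →L[ℝ] H) - (Δ k : H →L[ℝ] H)‖) :
    ∃ JA JB : ℕ → H → H,
      (∀ k v, SetValued.resolvent (SetValued.precond (Δ k : H →L[ℝ] H) A) v = {JA k v}) ∧
      (∀ k v, SetValued.resolvent (SetValued.precond (Δ k : H →L[ℝ] H) B) v = {JB k v}) ∧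
      ∀ w : ℕ → H,
        (∀ k, w (k + 1) =
          w k + JB k ((2 : ℝ) • JA k (w k) - w k) - JA k (w k)) →
        ∃ x ∈ SetValued.zer (A + B),
          Tendsto (fun k => toWeakSpace ℝ H (JA k (w k))) atTop (𝓝 (toWeakSpace ℝ H x)) := by
  choose JA hJA using fun k v => hA.exists_resolvent_eq_singleton (hpos k) v
  choose JB hJB using fun k v => hB.exists_resolvent_eq_singleton (hpos k) v
  refine ⟨JA, JB, hJA, hJB, fun w hw => ?_⟩
  have ha : ∀ k, (Δ k).symm (w k - JA k (w k)) ∈ A (JA k (w k)) := fun k =>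
    SetValued.mem_resolvent_precond_iff.1 (by rw [hJA]; rfl)
  have hb : ∀ k, (Δ k).symm ((2 : ℝ) • JA k (w k) - w k - JB k ((2 : ℝ) • JA k (w k) - w k)) ∈
      B (JB k ((2 : ℝ) • JA k (w k) - w k)) := fun k =>
    SetValued.mem_resolvent_precond_iff.1 (by rw [hJB]; rfl)
  obtain ⟨x, hx, hlim⟩ := SetValued.exists_weaklyTendsto_douglasRachford hA hB hzer
    (C := max 1 (max Cup Clow)) (le_max_left _ _)
    (fun k => (hup k).trans ((le_max_left _ _).trans (le_max_right _ _)))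
    (fun k => (hlow k).trans ((le_max_right _ _).trans (le_max_right _ _)))
    hpos hposlim hconv hsum ha hb
    (fun k => by
      rw [map_add, ContinuousLinearEquiv.apply_symm_apply, ContinuousLinearEquiv.apply_symm_apply,
        two_smul]
      abel)
    (fun k => by
      rw [ContinuousLinearEquiv.apply_symm_apply, ContinuousLinearEquiv.apply_symm_apply,
        add_sub_cancel, add_sub_cancel, hw k])
  exact ⟨x, hx, SetValued.weaklyTendsto_iff_toWeakSpace.1 hlim⟩
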